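/- Let $0\le\rho<1$ and let $Y\ge 0$ be a random variable with the $(1-\rho)$-Mittag-Leffler distribution, i.e. its Laplace transform is $$\mathbb E\big(e^{-uY}\big)=E_{1-\rho}(u):=\sum_{k=0}^{\infty}\frac{(-u)^k}{\Gamma\big((1-\rho)k+1\big)}\qquad(u\ge 0).$$ Then for every $s\in\mathbb C$ with $\operatorname{Re}(s)>0$ the Mellin transform of the distribution of $Y$, $$\mathcal M Y(s):=\int_{(0,\infty)}x^{s-1}\,\mathbb P(Y\in dx),$$ converges absolutely, and $$\mathcal M Y(s)=\frac{\Gamma(s)}{\Gamma\big((1-\rho)(s-1)+1\big)}.$$ In particular, if $Y$ has a density $f$ with respect to Lebesgue measure, then the Mellin integral $\int_0^\infty f(x)\,x^{s-1}\,dx$ converges absolutely and has this same value. -/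

import Mathlib

open MeasureTheory Set

/-- The Mittag-Leffler function `E_a(u) = ∑ (-u)^k / Γ(a k + 1)`, with the sign convention under
which it is a Laplace transform. The series converges for every complex `u` when `0 < a`. -/
noncomputable def mittagLefflerE (a : ℝ) (u : ℂ) : ℂ :=
  ∑' k : ℕ, (-u) ^ k / Complex.Gamma ((a : ℂ) * (k : ℂ) + 1)

/-- The random variable `Y` has the `a`-Mittag-Leffler distribution under `P`: it is nonnegative
and its Laplace transform `𝔼[exp (-u Y)]`, `u ≥ 0`, is `E_a(u)`. -/
def IsMittagLeffler {Ω : Type*} [MeasurableSpace Ω] (a : ℝ) (Y : Ω → ℝ) (P : Measure Ω) : Prop :=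
  (∀ᵐ ω ∂P, 0 ≤ Y ω) ∧
    ∀ u : ℝ, 0 ≤ u → ∫ ω, Complex.exp (-(u : ℂ) * (Y ω : ℂ)) ∂P = mittagLefflerE a (u : ℂ)

/-- The distribution `μ` has a Mellin transform at `s`, equal to `m`: the integral
`∫ x ^ (s - 1) μ(dx)` over `(0, ∞)` converges absolutely and has the value `m`. -/
def HasMellinOfMeasure (μ : Measure ℝ) (s m : ℂ) : Prop :=
  IntegrableOn (fun x : ℝ => (x : ℂ) ^ (s - 1)) (Ioi 0) μ ∧
    ∫ x in Ioi 0, (x : ℂ) ^ (s - 1) ∂μ = m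

/-- `f` is a probability density of the real random variable `Y` with respect to Lebesgue
measure. -/
def IsDensityOf {Ω : Type*} [MeasurableSpace Ω] (f : ℝ → ℝ) (Y : Ω → ℝ) (P : Measure Ω) : Prop :=
  AEMeasurable f volume ∧ (∀ᵐ x : ℝ, 0 ≤ f x) ∧
    P.map Y = volume.withDensity (fun x => ENNReal.ofReal (f x))

/-! Put `a = 1 - ρ` and let `R` be standard exponential, independent of `Y`. Since `𝔼 R ^ (a k) =
Γ(a k + 1)`, averaging `E_a(v R ^ a)` cancels the Gamma factors and leaves `∑ (-v)^k = 1 / (1 + v)`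
for `0 < v < 1` (`integral_mittagLefflerE_stdExp`). By uniqueness of Laplace transforms
(`ext_of_laplace_eq`), `R ^ a * Y` is again standard exponential (`map_rpow_mul_eq_stdExp`).
Comparing Mellin transforms gives `Γ(a (s - 1) + 1) * 𝓜Y(s) = Γ(s)`, and Fubini supplies absolute
convergence. -/

/-- The standard exponential law, with density `exp (-x)` on `(0, ∞)`. -/
noncomputable def stdExp : Measure ℝ :=
  (volume.restrict (Ioi 0)).withDensity fun x => ENNReal.ofReal (Real.exp (-x))

lemma integrable_stdExp_iff {E : Type*} [NormedAddCommGroup E] [NormedSpace ℝ E] {g : ℝ → E} :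
    Integrable g stdExp ↔ IntegrableOn (fun x => Real.exp (-x) • g x) (Ioi 0) := by
  rw [stdExp, integrable_withDensity_iff_integrable_smul' (by fun_prop) (by simp)]
  simp [ENNReal.toReal_ofReal, Real.exp_nonneg, IntegrableOn]

lemma integral_stdExp {E : Type*} [NormedAddCommGroup E] [NormedSpace ℝ E] (g : ℝ → E) :
    ∫ x, g x ∂stdExp = ∫ x in Ioi 0, Real.exp (-x) • g x := by
  rw [stdExp, integral_withDensity_eq_integral_toReal_smul (by fun_prop) (by simp)]
  simp [ENNReal.toReal_ofReal, Real.exp_nonneg]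

lemma ae_stdExp_pos : ∀ᵐ x ∂stdExp, 0 < x :=
  (withDensity_absolutelyContinuous _ _).ae_le (ae_restrict_mem measurableSet_Ioi)

lemma integrable_cpow_stdExp {s : ℂ} (hs : 0 < s.re) :
    Integrable (fun x : ℝ => (x : ℂ) ^ (s - 1)) stdExp := by
  rw [integrable_stdExp_iff]
  simpa using Complex.GammaIntegral_convergent hs

lemma integral_cpow_stdExp {s : ℂ} (hs : 0 < s.re) :
    ∫ x : ℝ, (x : ℂ) ^ (s - 1) ∂stdExp = Complex.Gamma s := by
  rw [integral_stdExp, Complex.Gamma_eq_integral hs, Complex.GammaIntegral]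
  simp

lemma integral_rpow_stdExp {s : ℝ} (hs : 0 < s) :
    ∫ x : ℝ, x ^ (s - 1) ∂stdExp = Real.Gamma s := by
  rw [integral_stdExp, Real.Gamma_eq_integral hs]
  simp

/-- The total mass is `Γ(1) = 1`; integrability of the constant `1` first rules out infinite mass.
-/
instance : IsProbabilityMeasure stdExp := by
  have h := integrable_cpow_stdExp (s := 1) (by simp)
  have h' := integral_cpow_stdExp (s := 1) (by simp)
  simp only [sub_self, Complex.cpow_zero] at h h'
  have : IsFiniteMeasure stdExp := by
    rcases integrable_const_iff.1 h with h | h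
    · simp at h
    · exact h
  rw [isProbabilityMeasure_iff_real]
  rw [integral_const, Complex.Gamma_one, Complex.real_smul, mul_one] at h'
  exact_mod_cast h'

lemma integral_exp_stdExp {v : ℝ} (hv : 0 ≤ v) :
    ∫ x : ℝ, Complex.exp (-(v : ℂ) * (x : ℂ)) ∂stdExp = (1 + (v : ℂ))⁻¹ := by
  rw [integral_stdExp]
  have h := integral_exp_mul_complex_Ioi (a := -(1 + (v : ℂ))) (by simp; linarith) 0
  rw [← setIntegral_congr_fun (f := fun x : ℝ => Complex.exp (-(1 + (v : ℂ)) * x))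
    measurableSet_Ioi, h]
  · rw [Complex.ofReal_zero, mul_zero, Complex.exp_zero, neg_div_neg_eq, one_div]
  · intro x _
    simp only [Complex.real_smul, Complex.ofReal_exp, ← Complex.exp_add]
    congr 1
    push_cast
    ring

section Laplace

open ProbabilityTheory Filter Topology

lemma integrable_cexp_mul_of_nonneg {μ : Measure ℝ} [IsFiniteMeasure μ] (hμ : ∀ᵐ x ∂μ, 0 ≤ x)
    {z : ℂ} (hz : z.re ≤ 0) : Integrable (fun x : ℝ => Complex.exp (z * x)) μ := by
  refine Integrable.of_bound (by fun_prop) 1 ?_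
  filter_upwards [hμ] with x hx
  rw [Complex.norm_exp]
  simpa using mul_nonpos_of_nonpos_of_nonneg hz hx

lemma Iio_subset_interior_integrableExpSet {μ : Measure ℝ} [IsFiniteMeasure μ]
    (hμ : ∀ᵐ x ∂μ, 0 ≤ x) : Iio 0 ⊆ interior (integrableExpSet id μ) := by
  refine interior_maximal (fun t ht => ?_) isOpen_Iio
  have h := (integrable_cexp_mul_of_nonneg hμ (z := t) (by simpa using (mem_Iio.1 ht).le)).norm
  simpa [integrableExpSet, Complex.norm_exp] using h

/-- Analyticity is available only on the open half-plane `re < 0`, so the characteristic function is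
recovered as a boundary value on the imaginary axis. -/
lemma tendsto_complexMGF_charFun {μ : Measure ℝ} [IsFiniteMeasure μ]
    (hμ : ∀ᵐ x ∂μ, 0 ≤ x) (t : ℝ) :
    Tendsto (fun n : ℕ => complexMGF id μ (-(1 / ((n : ℝ) + 1) : ℝ) + t * Complex.I)) atTop
      (𝓝 (charFun μ t)) := by
  rw [← complexMGF_id_mul_I]
  have hlim : Tendsto (fun n : ℕ => (-(1 / ((n : ℝ) + 1) : ℝ) + t * Complex.I : ℂ)) atTop
      (𝓝 (t * Complex.I)) := by
    have h := (Complex.continuous_ofReal.tendsto 0).comp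
      (tendsto_one_div_add_atTop_nhds_zero_nat (𝕜 := ℝ))
    simpa using h.neg.add_const (t * Complex.I)
  refine tendsto_integral_of_dominated_convergence (fun _ => 1) ?_ (by simp) ?_ ?_
  · intro n
    fun_prop
  · intro n
    filter_upwards [hμ] with x hx
    have hr : 0 < 1 / ((n : ℝ) + 1) := by positivity
    generalize 1 / ((n : ℝ) + 1) = r at hr
    rw [Complex.norm_exp]
    simpa using mul_nonneg hr.le hx
  · refine Eventually.of_forall fun x => ?_
    exact (Complex.continuous_exp.tendsto _).comp (hlim.mul_const _)

/-- Finite measures on `[0, ∞)` whose Laplace transforms agree on `(0, 1)` are equal. -/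
theorem ext_of_laplace_eq {μ ν : Measure ℝ} [IsFiniteMeasure μ] [IsFiniteMeasure ν]
    (hμ : ∀ᵐ x ∂μ, 0 ≤ x) (hν : ∀ᵐ x ∂ν, 0 ≤ x)
    (h : ∀ v ∈ Ioo (0 : ℝ) 1, ∫ x : ℝ, Complex.exp (-(v : ℂ) * (x : ℂ)) ∂μ =
      ∫ x : ℝ, Complex.exp (-(v : ℂ) * (x : ℂ)) ∂ν) : μ = ν := by
  have key : EqOn (complexMGF id μ) (complexMGF id ν) {z | z.re < 0} := by
    refine AnalyticOnNhd.eqOn_of_preconnected_of_frequently_eq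
      (analyticOnNhd_complexMGF.mono fun z hz => Iio_subset_interior_integrableExpSet hμ hz)
      (analyticOnNhd_complexMGF.mono fun z hz => Iio_subset_interior_integrableExpSet hν hz)
      -- The point `-1/2` is interior to `(-1, 0)`, the reflection of the interval where the
      -- transforms agree.
      (convex_halfSpace_re_lt 0).isPreconnected (z₀ := ((-(1 / 2) : ℝ) : ℂ)) (by simp) ?_
    have h_real : ∃ᶠ x : ℝ in 𝓝[≠] (-(1 / 2)), complexMGF id μ x = complexMGF id ν x := by
      refine Eventually.frequently ?_
      have : Ioo (-1 : ℝ) 0 ∈ 𝓝[≠] (-(1 / 2) : ℝ) :=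
        mem_nhdsWithin_of_mem_nhds (Ioo_mem_nhds (by norm_num) (by norm_num))
      filter_upwards [this] with x hx
      simpa [complexMGF] using h (-x) ⟨by linarith [hx.2], by linarith [hx.1]⟩
    refine Tendsto.frequently (f := fun x : ℝ => (x : ℂ)) ?_ h_real
    refine tendsto_nhdsWithin_iff.2 ⟨?_, ?_⟩
    · exact (Complex.continuous_ofReal.tendsto _).mono_left nhdsWithin_le_nhds
    · filter_upwards [self_mem_nhdsWithin] with x hx
      exact fun h => hx (Complex.ofReal_injective h)
  refine Measure.ext_of_charFun (funext fun t => ?_)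
  refine tendsto_nhds_unique (tendsto_complexMGF_charFun hμ t) ?_
  refine (tendsto_complexMGF_charFun hν t).congr fun n => (key ?_).symm
  have hr : 0 < 1 / ((n : ℝ) + 1) := by positivity
  generalize 1 / ((n : ℝ) + 1) = r at hr
  simpa using hr

end Laplace

lemma integral_mittagLefflerE_stdExp {a v : ℝ} (ha : 0 < a) (hv : v ∈ Ioo (0 : ℝ) 1) :
    ∫ r : ℝ, mittagLefflerE a ((v * r ^ a : ℝ) : ℂ) ∂stdExp = (1 + (v : ℂ))⁻¹ := by
  have hpos : ∀ k : ℕ, 0 < a * k + 1 := fun k => by positivity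
  have hG : ∀ k : ℕ, Complex.Gamma ((a : ℂ) * k + 1) = (Real.Gamma (a * k + 1) : ℂ) := fun k => by
    rw [← Complex.Gamma_ofReal]
    push_cast
    rfl
  have hG0 : ∀ k : ℕ, Real.Gamma (a * k + 1) ≠ 0 := fun k => (Real.Gamma_pos_of_pos (hpos k)).ne'
  let F : ℕ → ℝ → ℂ := fun k r =>
    (((-v) ^ k / Real.Gamma (a * k + 1) : ℝ) : ℂ) * (r : ℂ) ^ (((a * k + 1 : ℝ) : ℂ) - 1)
  have hF : ∀ k, ∀ r : ℝ, 0 < r → F k r =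
      (((-v) ^ k / Real.Gamma (a * k + 1) * r ^ (a * k + 1 - 1) : ℝ) : ℂ) := fun k r hr => by
    simp only [F]
    rw [Complex.ofReal_mul, Complex.ofReal_cpow hr.le]
    push_cast
    rfl
  have hterm : ∀ r : ℝ, 0 < r → mittagLefflerE a ((v * r ^ a : ℝ) : ℂ) = ∑' k, F k r := by
    intro r hr
    refine tsum_congr fun k => ?_
    rw [hF k r hr, hG, add_sub_cancel_right, Real.rpow_mul_natCast hr.le]
    push_cast
    rw [neg_mul_eq_neg_mul, mul_pow]
    ring
  have hint : ∀ k, Integrable (F k) stdExp := fun k =>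
    (integrable_cpow_stdExp (by simpa using hpos k)).const_mul _
  have hval : ∀ k, ∫ r, F k r ∂stdExp = (-(v : ℂ)) ^ k := fun k => by
    simp only [F]
    rw [integral_const_mul, integral_cpow_stdExp (by simpa using hpos k), Complex.Gamma_ofReal,
      ← Complex.ofReal_mul, div_mul_cancel₀ _ (hG0 k)]
    push_cast
    rfl
  have hnorm : ∀ k, ∫ r, ‖F k r‖ ∂stdExp = v ^ k := fun k => by
    have : ∀ᵐ r ∂stdExp, ‖F k r‖ =
        v ^ k / Real.Gamma (a * k + 1) * r ^ (a * k + 1 - 1) := by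
      filter_upwards [ae_stdExp_pos] with r hr
      rw [hF k r hr, Complex.norm_real, norm_mul, norm_div, norm_pow, norm_neg,
        Real.norm_of_nonneg hv.1.le, Real.norm_of_nonneg (Real.Gamma_pos_of_pos (hpos k)).le,
        Real.norm_of_nonneg (Real.rpow_nonneg hr.le _)]
    rw [integral_congr_ae this, integral_const_mul, integral_rpow_stdExp (hpos k),
      div_mul_cancel₀ _ (hG0 k)]
  -- Swapping sum and integral needs `∑ v ^ k < ∞`, hence the restriction `v < 1`.
  have hsum := hasSum_integral_of_summable_integral_norm hint (by
    simpa only [hnorm] using summable_geometric_of_lt_one hv.1.le hv.2)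
  rw [integral_congr_ae (ae_stdExp_pos.mono hterm), ← hsum.tsum_eq]
  simp only [hval]
  rw [tsum_geometric_of_norm_lt_one (by simpa [abs_of_pos hv.1] using hv.2), sub_neg_eq_add]

/-- If `R` is standard exponential and `Y` is an independent `a`-Mittag-Leffler variable with law
`Q`, then `R ^ a * Y` is standard exponential. -/
theorem map_rpow_mul_eq_stdExp {a : ℝ} (ha : 0 < a) {Q : Measure ℝ} [IsProbabilityMeasure Q]
    (hQ : IsMittagLeffler a id Q) :
    (stdExp.prod Q).map (fun p : ℝ × ℝ => p.1 ^ a * p.2) = stdExp := by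
  have hm : Measurable fun p : ℝ × ℝ => p.1 ^ a * p.2 := by fun_prop
  have hnn : ∀ᵐ p ∂stdExp.prod Q, 0 ≤ p.1 ^ a * p.2 := by
    filter_upwards [Measure.quasiMeasurePreserving_fst.ae ae_stdExp_pos,
      Measure.quasiMeasurePreserving_snd.ae hQ.1] with p hp hp'
    exact mul_nonneg (Real.rpow_nonneg hp.le _) hp'
  have hnn' : ∀ᵐ x ∂(stdExp.prod Q).map (fun p : ℝ × ℝ => p.1 ^ a * p.2), 0 ≤ x :=
    (ae_map_iff hm.aemeasurable measurableSet_Ici).2 hnn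
  have : IsProbabilityMeasure ((stdExp.prod Q).map (fun p : ℝ × ℝ => p.1 ^ a * p.2)) :=
    Measure.isProbabilityMeasure_map hm.aemeasurable
  refine ext_of_laplace_eq hnn' (ae_stdExp_pos.mono fun _ h => h.le) fun v hv => ?_
  have hi := integrable_cexp_mul_of_nonneg hnn' (z := -(v : ℂ)) (by simpa using hv.1.le)
  rw [integrable_map_measure (by fun_prop) hm.aemeasurable] at hi
  rw [integral_map hm.aemeasurable (by fun_prop)]
  refine (integral_prod _ hi).trans ?_
  rw [integral_exp_stdExp hv.1.le,
    ← integral_mittagLefflerE_stdExp ha hv]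
  refine integral_congr_ae ?_
  filter_upwards [ae_stdExp_pos] with r hr
  rw [← hQ.2 _ (mul_nonneg hv.1.le (Real.rpow_nonneg hr.le _))]
  refine integral_congr_ae (Filter.Eventually.of_forall fun y => ?_)
  simp only [id, Function.comp_apply]
  push_cast
  ring_nf

theorem hasMellinOfMeasure_of_isMittagLeffler {a : ℝ} (ha : 0 < a) (ha1 : a ≤ 1) {Q : Measure ℝ}
    [IsProbabilityMeasure Q] (hQ : IsMittagLeffler a id Q) {s : ℂ} (hs : 0 < s.re) :
    HasMellinOfMeasure Q s (Complex.Gamma s / Complex.Gamma (a * (s - 1) + 1)) := by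
  -- Here `a ≤ 1` enters: `a (re s - 1) + 1 > 1 - a ≥ 0`.
  have hs' : 0 < ((a : ℂ) * (s - 1) + 1).re := by
    simp
    nlinarith
  -- The cutoff discards a possible atom of `Q` at `0` and makes the factorization `hprod` hold
  -- there too.
  let g : ℝ → ℂ := (Ioi 0).indicator fun x => (x : ℂ) ^ (s - 1)
  let h : ℝ → ℂ := fun r => (r : ℂ) ^ ((a : ℂ) * (s - 1) + 1 - 1)
  have hgm : Measurable g := Measurable.indicator (by fun_prop) measurableSet_Ioi
  have hm : Measurable fun p : ℝ × ℝ => p.1 ^ a * p.2 := by fun_prop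
  have hg : g =ᵐ[stdExp] fun x : ℝ => (x : ℂ) ^ (s - 1) :=
    ae_stdExp_pos.mono fun x hx => indicator_of_mem (mem_Ioi.2 hx) _
  have hgi : Integrable g stdExp := (integrable_cpow_stdExp hs).congr hg.symm
  have hprod : (fun p : ℝ × ℝ => g (p.1 ^ a * p.2)) =ᵐ[stdExp.prod Q]
      fun p => h p.1 * g p.2 := by
    filter_upwards [Measure.quasiMeasurePreserving_fst.ae ae_stdExp_pos] with p hp
    have hpa : 0 < p.1 ^ a := Real.rpow_pos_of_pos hp a
    by_cases hy : 0 < p.2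
    · simp only [g, h, indicator_of_mem (mem_Ioi.2 hy), indicator_of_mem (mem_Ioi.2 (mul_pos hpa hy)),
        add_sub_cancel_right]
      rw [Complex.ofReal_mul, Complex.mul_cpow_ofReal_nonneg hpa.le hy.le,
        Complex.cpow_def_of_ne_zero (Complex.ofReal_ne_zero.2 hpa.ne'),
        Complex.cpow_def_of_ne_zero (Complex.ofReal_ne_zero.2 hp.ne'), ← Complex.ofReal_log hpa.le,
        ← Complex.ofReal_log hp.le, Real.log_rpow hp, Complex.ofReal_mul]
      congr 2
      ring
    · have hy' : ¬ 0 < p.1 ^ a * p.2 := fun h0 => hy (pos_of_mul_pos_right h0 hpa.le)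
      simp [g, hy, hy']
  have hint : Integrable (fun p : ℝ × ℝ => h p.1 * g p.2) (stdExp.prod Q) := by
    refine Integrable.congr ?_ hprod
    rw [← map_rpow_mul_eq_stdExp ha hQ] at hgi
    exact (integrable_map_measure hgm.aestronglyMeasurable hm.aemeasurable).1 hgi
  have hgQ : Integrable g Q := by
    -- A single integrable section with `r > 0` suffices, since then `h r ≠ 0` can be divided out.
    obtain ⟨r, hr, hr0⟩ := (hint.prod_right_ae.and ae_stdExp_pos).exists
    refine (integrable_const_mul_iff (IsUnit.mk0 (h r) ?_) g).1 hr
    simp [h, Complex.cpow_eq_zero_iff, hr0.ne']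
  refine ⟨(integrable_indicator_iff measurableSet_Ioi).1 hgQ, ?_⟩
  rw [eq_div_iff (Complex.Gamma_ne_zero_of_re_pos hs'), ← integral_indicator measurableSet_Ioi,
    mul_comm, ← integral_cpow_stdExp hs', ← integral_prod_mul, ← integral_congr_ae hprod,
    ← integral_cpow_stdExp hs, ← integral_congr_ae hg]
  conv_rhs => rw [← map_rpow_mul_eq_stdExp ha hQ]
  rw [integral_map hm.aemeasurable hgm.aestronglyMeasurable]

lemma IsMittagLeffler.map {Ω : Type*} [MeasurableSpace Ω] {P : Measure Ω} {a : ℝ} {Y : Ω → ℝ}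
    (hY : AEMeasurable Y P) (h : IsMittagLeffler a Y P) : IsMittagLeffler a id (P.map Y) := by
  refine ⟨(ae_map_iff hY measurableSet_Ici).2 h.1, fun u hu => ?_⟩
  rw [integral_map hY (by fun_prop)]
  exact h.2 u hu

lemma HasMellinOfMeasure.hasMellin {f : ℝ → ℝ} (hf : AEMeasurable f volume)
    (hf0 : ∀ᵐ x : ℝ, 0 ≤ f x) {s m : ℂ}
    (h : HasMellinOfMeasure (volume.withDensity fun x => ENNReal.ofReal (f x)) s m) :
    HasMellin (fun x : ℝ => (f x : ℂ)) s m := by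
  have hfm : AEMeasurable (fun x => ENNReal.ofReal (f x)) (volume.restrict (Ioi 0)) :=
    hf.ennreal_ofReal.restrict
  have hcongr : (fun x : ℝ => (ENNReal.ofReal (f x)).toReal • (x : ℂ) ^ (s - 1))
      =ᵐ[volume.restrict (Ioi 0)] fun x : ℝ => (x : ℂ) ^ (s - 1) • (f x : ℂ) := by
    filter_upwards [ae_restrict_of_ae hf0] with x hx
    rw [ENNReal.toReal_ofReal hx, Complex.real_smul, smul_eq_mul, mul_comm]
  obtain ⟨h1, h2⟩ := h
  rw [IntegrableOn, restrict_withDensity measurableSet_Ioi,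
    integrable_withDensity_iff_integrable_smul₀' hfm (by simp)] at h1
  rw [restrict_withDensity measurableSet_Ioi,
    integral_withDensity_eq_integral_toReal_smul₀ hfm (by simp)] at h2
  refine ⟨h1.congr hcongr, ?_⟩
  rw [mellin, ← integral_congr_ae hcongr, h2]

theorem mainTheorem8 {Ω : Type*} [MeasurableSpace Ω] (P : Measure Ω) [IsProbabilityMeasure P]
    (ρ : ℝ) (hρ0 : 0 ≤ ρ) (hρ1 : ρ < 1) (Y : Ω → ℝ) (hY : AEMeasurable Y P)
    (hML : IsMittagLeffler (1 - ρ) Y P) (s : ℂ) (hs : 0 < s.re) :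
    HasMellinOfMeasure (P.map Y) s
        (Complex.Gamma s / Complex.Gamma ((1 - (ρ : ℂ)) * (s - 1) + 1)) ∧
      ∀ f : ℝ → ℝ, IsDensityOf f Y P →
        HasMellin (fun x : ℝ => (f x : ℂ)) s
          (Complex.Gamma s / Complex.Gamma ((1 - (ρ : ℂ)) * (s - 1) + 1)) := by
  have : IsProbabilityMeasure (P.map Y) := Measure.isProbabilityMeasure_map hY
  have h := hasMellinOfMeasure_of_isMittagLeffler (sub_pos.2 hρ1) (sub_le_self 1 hρ0)
    (hML.map hY) hs
  push_cast at h
  refine ⟨h, fun f hf => HasMellinOfMeasure.hasMellin hf.1 hf.2.1 ?_⟩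
  rwa [← hf.2.2]
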